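/- Let $\mathbb{F}$ be an infinite field of arbitrary characteristic, let $\mathsf{A}_1=\mathbb{F}\langle x,y\rangle/(yx-xy-1)$ be the Weyl algebra over $\mathbb{F}$, and let $\mathsf{V}\subset\mathsf{A}_1$ be the $\mathbb{F}$-span of $x$ and $y$. Let $\mathbb{F}\langle X\rangle$ be the free unital associative $\mathbb{F}$-algebra on the letters $x_1,x_2,\ldots$. An element $f=f(x_1,\ldots,x_m)$ of $\mathbb{F}\langle X\rangle$ is called a weak polynomial identity for the pair $(\mathsf{A}_1,\mathsf{V})$ if $f(a_1,\ldots,a_m)=0$ in $\mathsf{A}_1$ for all $a_1,\ldots,a_m\in\mathsf{V}$. Writing $[a,b]=ab-ba$, let $\mathcal{I}$ be the two-sided ideal of $\mathbb{F}\langle X\rangle$ generated by the elements $$\Gamma_3(x_i,x_j,x_k)=[[x_i,x_j],x_k],$$ $$\mathrm{St}_3(x_i,x_j,x_k)=x_i[x_j,x_k]-x_j[x_i,x_k]+x_k[x_i,x_j],$$ $$T_4(x_i,x_j,x_k,x_l)=[x_i,x_j][x_k,x_l]-[x_i,x_k][x_j,x_l]+[x_j,x_k][x_i,x_l]$$ for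 all $i,j,k,l\geq 1$. Then every weak polynomial identity $f\in\mathbb{F}\langle X\rangle$ for the pair $(\mathsf{A}_1,\mathsf{V})$ of degree $5$ lies in $\mathcal{I}$. (The degree of $f$ is the maximal length of a word occurring in $f$ with nonzero coefficient; $f$ need not be homogeneous.) -/

import Mathlib

namespace WeylWeakIdentities

open FreeAlgebra

section General

variable (F : Type*) [Field F]

/-- The free unital associative algebra on countably many letters; the letters
`x₁, x₂, …` are indexed by `ℕ`, that is, starting from `0`. -/
abbrev FreeAlg : Type _ := FreeAlgebra F ℕ

variable {F}

/-- The letter with index `i`. -/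
abbrev X (i : ℕ) : FreeAlg F := FreeAlgebra.ι F i

/-- The degree of a noncommutative polynomial: the largest length of a word that occurs in it
with nonzero coefficient (and `0` for the zero polynomial). -/
noncomputable def degree (f : FreeAlg F) : ℕ :=
  (FreeAlgebra.equivMonoidAlgebraFreeMonoid f).coeff.support.sup FreeMonoid.length

/-- `f` is a polynomial identity for the subspace `V` of the algebra `A`: it vanishes under every
substitution of elements of `V` for the letters. -/
def IsIdentityOn {A : Type*} [Ring A] [Algebra F A] (V : Submodule F A) (f : FreeAlg F) : Prop :=
  ∀ a : ℕ → A, (∀ i, a i ∈ V) → FreeAlgebra.lift F a f = 0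

end General

section Weyl

variable (F : Type*) [Field F]

/-- The defining relation `y x = x y + 1`, where `x`, `y` are the letters `0`, `1` of the free
algebra on two letters. -/
inductive WeylRel : FreeAlgebra F (Fin 2) → FreeAlgebra F (Fin 2) → Prop
  | rel : WeylRel (ι F 1 * ι F 0) (ι F 0 * ι F 1 + 1)

/-- The Weyl algebra `A₁ = F⟨x, y⟩ / (y x - x y - 1)`. -/
abbrev WeylAlgebra : Type _ := RingQuot (WeylRel F)

/-- The generator `x` of the Weyl algebra. -/
noncomputable def weylX : WeylAlgebra F := RingQuot.mkAlgHom F (WeylRel F) (ι F 0)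

/-- The generator `y` of the Weyl algebra. -/
noncomputable def weylY : WeylAlgebra F := RingQuot.mkAlgHom F (WeylRel F) (ι F 1)

/-- The subspace `V` of the Weyl algebra spanned by `x` and `y`. -/
noncomputable def weylV : Submodule F (WeylAlgebra F) := Submodule.span F {weylX F, weylY F}

/-- `f` is a weak polynomial identity for the pair `(A₁, V)`. -/
def IsWeakIdentity (f : FreeAlg F) : Prop := IsIdentityOn (weylV F) f

end Weyl

section TheIdeal

variable (F : Type*) [Field F]

/-- `Γ₃(a, b, c) = [[a, b], c]`. -/
def Gamma3 {A : Type*} [Ring A] (a b c : A) : A := ⁅⁅a, b⁆, c⁆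

/-- `St₃(a, b, c) = a [b, c] - b [a, c] + c [a, b]`. -/
def St3 {A : Type*} [Ring A] (a b c : A) : A := a * ⁅b, c⁆ - b * ⁅a, c⁆ + c * ⁅a, b⁆

/-- `T₄(a, b, c, d) = [a, b] [c, d] - [a, c] [b, d] + [b, c] [a, d]`. -/
def T4 {A : Type*} [Ring A] (a b c d : A) : A :=
  ⁅a, b⁆ * ⁅c, d⁆ - ⁅a, c⁆ * ⁅b, d⁆ + ⁅b, c⁆ * ⁅a, d⁆

/-- The two-sided ideal of the free algebra generated by all `Γ₃(xᵢ, xⱼ, xₖ)`,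
`St₃(xᵢ, xⱼ, xₖ)` and `T₄(xᵢ, xⱼ, xₖ, xₗ)`. As these three polynomials are multilinear, it is also
the ideal generated by their values on linear combinations of letters (the L-ideal). -/
def idealI : TwoSidedIdeal (FreeAlg F) :=
  TwoSidedIdeal.span
    ({f | ∃ i j k : ℕ, f = Gamma3 (X i) (X j) (X k)} ∪
      {f | ∃ i j k : ℕ, f = St3 (X i) (X j) (X k)} ∪
      {f | ∃ i j k l : ℕ, f = T4 (X i) (X j) (X k) (X l)})

end TheIdeal

end WeylWeakIdentities

namespace WeylWeakIdentities

open Polynomial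

/-! Modulo the ideal, commutators of letters are central, and `St₃` and `T₄` become Plücker-type
exchange relations. They reduce every element to a combination of standard tableaux: sorted letters
times sorted commutators (`tableau_mem`). Reduction terminates because, with `[i, k]` seen as an arc
from `i` to `k` and a letter `j` as an arc from `-1` to `j`, an exchange trades two nested arcs for
two crossing or two disjoint ones, and reordering two letters costs a term with one arc joining
their ends. All of these have a smaller sum of squared lengths.

Conversely, let the letter `j` act on polynomials in `X` as `αⱼ X + βⱼ d/dX` with indeterminate
`αⱼ`, `βⱼ`. A suitable weight gives each standard tableau, applied to `1`, a leading monomial with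
coefficient `1`, in any characteristic, and the tableau can be read off from it. So standard
tableaux act independently (`eq_zero_of_genericAction_eq_zero`).

The ideal acts as zero. So does a weak identity, since it vanishes at all specializations of `αⱼ`,
`βⱼ` in the infinite field. Hence its standard form is zero, and it lies in the ideal. -/

/-- The relations among the letters `a i` that allow straightening: commutators of letters are
central, and `St₃` and `T₄` vanish on letters. -/
structure StraighteningRelations {A : Type*} [Ring A] (a : ℕ → A) : Prop where
  gamma3 : ∀ i j k, Gamma3 (a i) (a j) (a k) = 0
  st3 : ∀ i j k, St3 (a i) (a j) (a k) = 0
  t4 : ∀ i j k l, T4 (a i) (a j) (a k) (a l) = 0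

/-- The product of the letters indexed by `as` and of the commutators indexed by `P`. -/
def tableau {A : Type*} [Ring A] (a : ℕ → A) (as : List ℕ) (P : List (ℕ × ℕ)) : A :=
  (as.map a).prod * (P.map fun p => ⁅a p.1, a p.2⁆).prod

/-- The standard index pairs: the two rows of the associated two-row tableau increase weakly, and
its columns increase strictly. -/
def IsStandard (as : List ℕ) (P : List (ℕ × ℕ)) : Prop :=
  (as ++ P.map Prod.snd).Pairwise (· ≤ ·) ∧ (P.map Prod.fst).Pairwise (· ≤ ·) ∧
    ∀ p ∈ P, p.1 < p.2

/-- The measure on which straightening is an induction: the sum of the squared lengths of the arcs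
of an index pair, a letter `j` being an arc from `-1` to `j`. -/
def energy (as : List ℕ) (P : List (ℕ × ℕ)) : ℕ :=
  (as.map fun j => (j + 1) ^ 2).sum + (P.map fun p => (p.2 - p.1) ^ 2).sum

theorem energy_perm {as as' : List ℕ} {P P' : List (ℕ × ℕ)} (h : as.Perm as') (hP : P.Perm P') :
    energy as P = energy as' P' := by
  unfold energy
  rw [(h.map _).sum_eq, (hP.map _).sum_eq]

/-! ### Straightening: standard tableaux span. -/

section Straightening

variable {A : Type*} [Ring A] {a : ℕ → A}

theorem StraighteningRelations.commute_letter (h : StraighteningRelations a) (i j k : ℕ) :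
    Commute ⁅a i, a j⁆ (a k) := by
  have := h.gamma3 i j k
  rwa [Gamma3, Ring.lie_def ⁅a i, a j⁆, sub_eq_zero] at this

theorem StraighteningRelations.commute_letters (h : StraighteningRelations a) (i j : ℕ)
    (as : List ℕ) : Commute ⁅a i, a j⁆ (as.map a).prod := by
  refine Commute.list_prod_right _ _ fun x hx => ?_
  obtain ⟨k, -, rfl⟩ := List.mem_map.1 hx
  exact h.commute_letter i j k

theorem StraighteningRelations.commute_lie (h : StraighteningRelations a) (i j k l : ℕ) :
    Commute ⁅a i, a j⁆ ⁅a k, a l⁆ := by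
  have hk := h.commute_letter i j k
  have hl := h.commute_letter i j l
  rw [Ring.lie_def (a k)]
  exact (hk.mul_right hl).sub_right (hl.mul_right hk)

theorem StraighteningRelations.tableau_perm_right (h : StraighteningRelations a) (as : List ℕ)
    {P P' : List (ℕ × ℕ)} (hP : P.Perm P') : tableau a as P = tableau a as P' := by
  unfold tableau
  congr 1
  refine (hP.map _).prod_eq' (List.Pairwise.map _ (fun p q _ => h.commute_lie _ _ _ _)
    (List.pairwise_of_forall (R := fun _ _ => True) fun _ _ => trivial))

theorem StraighteningRelations.tableau_cons_right (h : StraighteningRelations a) (as : List ℕ)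
    (p : ℕ × ℕ) (P : List (ℕ × ℕ)) :
    tableau a as (p :: P) = ⁅a p.1, a p.2⁆ * tableau a as P := by
  simp only [tableau, List.map_cons, List.prod_cons, ← mul_assoc]
  rw [(h.commute_letters p.1 p.2 as).eq]

theorem StraighteningRelations.tableau_swap (h : StraighteningRelations a) (u v : List ℕ)
    (i j : ℕ) (P : List (ℕ × ℕ)) :
    tableau a (u ++ i :: j :: v) P = tableau a (u ++ j :: i :: v) P
      + tableau a (u ++ v) ((i, j) :: P) := by
  rw [h.tableau_cons_right]
  simp only [tableau, List.map_append, List.map_cons, List.prod_append, List.prod_cons]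
  have := (h.commute_letters i j u).eq
  have h2 : a i * a j = a j * a i + ⁅a i, a j⁆ := by rw [Ring.lie_def]; abel
  rw [← mul_assoc (a i), h2]
  simp only [← mul_assoc, mul_add, add_mul, this]

/-- This is `T₄(i, k, l, j)`. For `i < k < l < j` it trades nested arcs for a crossing pair and a
disjoint pair. -/
theorem StraighteningRelations.tableau_plucker (h : StraighteningRelations a) (as : List ℕ)
    (i j k l : ℕ) (P : List (ℕ × ℕ)) :
    tableau a as ((i, j) :: (k, l) :: P) = tableau a as ((i, l) :: (k, j) :: P)
      - tableau a as ((i, k) :: (l, j) :: P) := by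
  simp only [h.tableau_cons_right, ← mul_assoc]
  rw [← sub_mul]
  congr 1
  have := h.t4 i k l j
  rw [T4, (h.commute_lie k l i j).eq] at this
  rw [← sub_eq_zero, ← this]
  abel

/-- This is `St₃(i, k, j)`: the exchange of `tableau_plucker` with letters as arcs from `-1`. -/
theorem StraighteningRelations.tableau_st3 (h : StraighteningRelations a) (as : List ℕ)
    (i j k : ℕ) (P : List (ℕ × ℕ)) :
    tableau a (as ++ [j]) ((i, k) :: P) = tableau a (as ++ [k]) ((i, j) :: P)
      - tableau a (as ++ [i]) ((k, j) :: P) := by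
  simp only [tableau, List.map_append, List.prod_append, List.map_cons, List.prod_cons,
    List.map_nil, List.prod_nil, mul_one, mul_assoc]
  rw [← mul_sub]
  congr 1
  simp only [← mul_assoc]
  rw [← sub_mul]
  congr 1
  have := h.st3 i k j
  rw [St3] at this
  rw [← sub_eq_zero, ← this]
  abel

variable (F : Type*) [Field F] [Algebra F A]

/-- The span of the standard tableaux. -/
def standardSpan (a : ℕ → A) : Submodule F A :=
  Submodule.span F ((fun t : List ℕ × List (ℕ × ℕ) => tableau a t.1 t.2) ''
    {t | IsStandard t.1 t.2})

variable {F}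

/-- Each adjacent transposition of letters costs one term of lower energy, which `IH` covers. The
prefix `u` lets it happen anywhere in the word. -/
theorem StraighteningRelations.mem_of_perm_left (h : StraighteningRelations a)
    {S : Submodule F A} {N : ℕ} {P : List (ℕ × ℕ)} (hP : ∀ p ∈ P, p.1 < p.2)
    (IH : ∀ as P, (∀ p ∈ P, p.1 < p.2) → energy as P < N → tableau a as P ∈ S)
    {v v' : List ℕ} (hv : v.Perm v') : ∀ u, energy (u ++ v) P ≤ N → tableau a (u ++ v) P ∈ S →
      tableau a (u ++ v') P ∈ S := by
  induction hv with
  | nil => exact fun u _ hu => hu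
  | cons x _ ih =>
    intro u hN hu
    simpa using ih (u ++ [x]) (by simpa using hN) (by simpa using hu)
  | trans h1 h2 ih1 ih2 =>
    intro u hN hu
    exact ih2 u (energy_perm (h1.append_left u) (.refl P) ▸ hN) (ih1 u hN hu)
  | swap i j l =>
    intro u hN hu
    have key : ∀ i j : ℕ, i < j → energy (u ++ j :: i :: l) P ≤ N →
        tableau a (u ++ l) ((i, j) :: P) ∈ S := by
      intro i j hij hN
      refine IH _ _ (List.forall_mem_cons.2 ⟨hij, hP⟩) (lt_of_lt_of_le ?_ hN)
      obtain ⟨d, rfl⟩ := Nat.exists_eq_add_of_lt hij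
      have e : i + d + 1 - i = d + 1 := by omega
      simp only [energy, List.map_append, List.map_cons, List.sum_append, List.sum_cons, e]
      nlinarith
    -- The swap is expanded in whichever word has the two letters increasing, so that the new
    -- commutator has its smaller index first.
    rcases lt_trichotomy i j with hij | rfl | hij
    · rw [h.tableau_swap]
      exact add_mem hu (key i j hij hN)
    · exact hu
    · rw [h.tableau_swap] at hu
      refine (Submodule.add_mem_iff_left _ (key j i hij ?_)).1 hu
      rwa [energy_perm ((List.Perm.swap _ _ _).append_left u) (.refl P)]

/-- Once no arcs are nested, sorting suffices; the lexicographic order on pairs settles ties in the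
first index. -/
theorem StraighteningRelations.exists_isStandard {as : List ℕ} {P : List (ℕ × ℕ)}
    (hP : ∀ p ∈ P, p.1 < p.2) (h1 : ∀ j ∈ as, ∀ p ∈ P, j ≤ p.2)
    (h2 : ∀ p ∈ P, ∀ q ∈ P, p.1 < q.1 → p.2 ≤ q.2) :
    ∃ as' P', as'.Perm as ∧ P'.Perm P ∧ IsStandard as' P' := by
  let r : ℕ × ℕ → ℕ × ℕ → Prop := fun p q => toLex p ≤ toLex q
  have : Std.Total r := ⟨fun p q => le_total (toLex p) (toLex q)⟩
  have : IsTrans (ℕ × ℕ) r := ⟨fun p q s h h' => le_trans (α := ℕ ×ₗ ℕ) h h'⟩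
  have hs := List.pairwise_insertionSort r P
  refine ⟨as.insertionSort (· ≤ ·), P.insertionSort r, List.perm_insertionSort _ _,
    List.perm_insertionSort _ _, ?_, ?_, ?_⟩
  · rw [List.pairwise_append]
    refine ⟨List.pairwise_insertionSort _ _, ?_, ?_⟩
    · rw [List.pairwise_map]
      refine hs.imp_of_mem fun {p q} hp hq hr => ?_
      rw [List.mem_insertionSort] at hp hq
      rcases Prod.Lex.le_iff.1 hr with hr | hr
      · exact h2 p hp q hq hr
      · exact hr.2
    · intro j hj k hk
      obtain ⟨p, hp, rfl⟩ := List.mem_map.1 hk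
      exact h1 j (by simpa using hj) p (by simpa using hp)
  · rw [List.pairwise_map]
    refine hs.imp fun {p q} hr => ?_
    rcases Prod.Lex.le_iff.1 hr with hr | hr
    · exact hr.le
    · exact hr.1.le
  · intro p hp
    exact hP p (by simpa using hp)

theorem StraighteningRelations.tableau_mem (h : StraighteningRelations a) (as : List ℕ)
    (P : List (ℕ × ℕ)) (hP : ∀ p ∈ P, p.1 < p.2) : tableau a as P ∈ standardSpan F a := by
  induction hN : energy as P using Nat.strong_induction_on generalizing as P with
  | _ N IH =>
  have IH' : ∀ as P, (∀ p ∈ P, p.1 < p.2) → energy as P < N → tableau a as P ∈ standardSpan F a :=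
    fun as P hP hlt => IH _ hlt as P hP rfl
  have perm : ∀ {as' : List ℕ} {P' : List (ℕ × ℕ)}, as'.Perm as → P'.Perm P →
      tableau a as' P' ∈ standardSpan F a → tableau a as P ∈ standardSpan F a := by
    intro as' P' has hP' hmem
    rw [h.tableau_perm_right _ hP'] at hmem
    exact h.mem_of_perm_left hP IH' has [] (by simp [energy_perm has (.refl P), hN]) hmem
  -- A commutator arc nested in a letter arc.
  by_cases h1 : ∃ j ∈ as, ∃ p ∈ P, p.2 < j
  · obtain ⟨j, hj, ⟨i, k⟩, hp, hkj⟩ := h1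
    obtain ⟨as', has⟩ : ∃ as', as.Perm (as' ++ [j]) :=
      ⟨as.erase j, (List.perm_cons_erase hj).trans (List.perm_append_singleton _ _).symm⟩
    have hP' := List.perm_cons_erase hp
    set P' := P.erase (i, k)
    have hlt : ∀ p ∈ P', p.1 < p.2 := fun p hp => hP p (List.mem_of_mem_erase hp)
    have hik : i < k := hP _ hp
    refine perm has.symm hP'.symm ?_
    rw [h.tableau_st3]
    rw [energy_perm has hP'] at hN
    simp only at hkj
    obtain ⟨d, rfl⟩ := Nat.exists_eq_add_of_lt hik
    obtain ⟨e, rfl⟩ := Nat.exists_eq_add_of_lt hkj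
    have e1 : i + d + 1 - i = d + 1 := by omega
    have e2 : i + d + 1 + e + 1 - i = d + e + 2 := by omega
    have e3 : i + d + 1 + e + 1 - (i + d + 1) = e + 1 := by omega
    simp only [energy, List.map_append, List.map_cons, List.sum_append, List.sum_cons,
      List.map_nil, List.sum_nil, e1] at hN
    refine sub_mem (IH' _ _ ?_ ?_) (IH' _ _ ?_ ?_)
    · exact List.forall_mem_cons.2 ⟨by simp only; omega, hlt⟩
    · simp only [energy, List.map_append, List.map_cons, List.sum_append, List.sum_cons,
        List.map_nil, List.sum_nil, e2]
      nlinarith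
    · exact List.forall_mem_cons.2 ⟨by simp only; omega, hlt⟩
    · simp only [energy, List.map_append, List.map_cons, List.sum_append, List.sum_cons,
        List.map_nil, List.sum_nil, e3]
      nlinarith
  -- A commutator arc nested in another commutator arc.
  by_cases h2 : ∃ p ∈ P, ∃ q ∈ P, p.1 < q.1 ∧ q.2 < p.2
  · obtain ⟨⟨i, j⟩, hp, ⟨k, l⟩, hq, hik, hlj⟩ := h2
    have hkl : k < l := hP _ hq
    simp only at hik hlj
    have hP' : P.Perm ((i, j) :: (k, l) :: (P.erase (i, j)).erase (k, l)) := by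
      refine (List.perm_cons_erase hp).trans (.cons _ (List.perm_cons_erase ?_))
      rw [List.mem_erase_of_ne]
      · exact hq
      · intro he
        exact hik.ne' (congrArg Prod.fst he)
    set P' := (P.erase (i, j)).erase (k, l)
    have hlt : ∀ p ∈ P', p.1 < p.2 := fun p hp =>
      hP p (List.mem_of_mem_erase (List.mem_of_mem_erase hp))
    refine perm (.refl _) hP'.symm ?_
    rw [h.tableau_plucker]
    rw [energy_perm (.refl _) hP'] at hN
    obtain ⟨d, rfl⟩ := Nat.exists_eq_add_of_lt hik
    obtain ⟨e, rfl⟩ := Nat.exists_eq_add_of_lt hkl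
    obtain ⟨f, rfl⟩ := Nat.exists_eq_add_of_lt hlj
    have e1 : i + d + 1 + e + 1 + f + 1 - i = d + e + f + 3 := by omega
    have e2 : i + d + 1 + e + 1 - (i + d + 1) = e + 1 := by omega
    have e3 : i + d + 1 + e + 1 - i = d + e + 2 := by omega
    have e4 : i + d + 1 + e + 1 + f + 1 - (i + d + 1) = e + f + 2 := by omega
    have e5 : i + d + 1 - i = d + 1 := by omega
    have e6 : i + d + 1 + e + 1 + f + 1 - (i + d + 1 + e + 1) = f + 1 := by omega
    simp only [energy, List.map_cons, List.sum_cons, e1, e2] at hN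
    refine sub_mem (IH' _ _ ?_ ?_) (IH' _ _ ?_ ?_)
    · exact List.forall_mem_cons.2 ⟨by simp only; omega,
        List.forall_mem_cons.2 ⟨by simp only; omega, hlt⟩⟩
    · simp only [energy, List.map_cons, List.sum_cons, e3, e4]
      nlinarith
    · exact List.forall_mem_cons.2 ⟨by simp only; omega,
        List.forall_mem_cons.2 ⟨by simp only; omega, hlt⟩⟩
    · simp only [energy, List.map_cons, List.sum_cons, e5, e6]
      nlinarith
  push Not at h1 h2
  obtain ⟨as', P', has, hP', hst⟩ := exists_isStandard hP h1 h2
  exact perm has hP' (Submodule.subset_span ⟨(as', P'), hst, rfl⟩)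

theorem StraighteningRelations.lift_mem_standardSpan (h : StraighteningRelations a)
    (f : FreeAlg F) : FreeAlgebra.lift F a f ∈ standardSpan F a := by
  let W : Submodule F A := Submodule.span F (Set.range fun as : List ℕ => (as.map a).prod)
  have hW : W ≤ standardSpan F a := by
    rw [Submodule.span_le]
    rintro _ ⟨as, rfl⟩
    simpa [tableau] using h.tableau_mem (F := F) as [] (by simp)
  -- Stability of the span of words under left multiplication passes to products in the induction on
  -- `f`.
  have key : ∀ x ∈ W, FreeAlgebra.lift F a f * x ∈ W := by
    induction f using FreeAlgebra.induction with
    | grade0 r =>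
      intro x hx
      rw [AlgHom.commutes, ← Algebra.smul_def]
      exact W.smul_mem r hx
    | grade1 i =>
      intro x hx
      rw [FreeAlgebra.lift_ι_apply]
      induction hx using Submodule.span_induction with
      | mem x hx =>
        obtain ⟨as, rfl⟩ := hx
        exact Submodule.subset_span ⟨i :: as, by simp⟩
      | zero => simp
      | add x y _ _ hx hy => rw [mul_add]; exact add_mem hx hy
      | smul r x _ hx => rw [mul_smul_comm]; exact W.smul_mem r hx
    | mul f g hf hg =>
      intro x hx
      rw [map_mul, mul_assoc]
      exact hf _ (hg _ hx)
    | add f g hf hg =>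
      intro x hx
      rw [map_add, add_mul]
      exact add_mem (hf _ hx) (hg _ hx)
  simpa using hW (key 1 (Submodule.subset_span ⟨[], by simp⟩))

end Straightening

/-! ### The polynomial representation. -/

/-- The operator `α j • X + β j • d/dX` on polynomials, by which `α j • x + β j • y` acts. -/
noncomputable def letterOp {R : Type*} [CommRing R] (α β : ℕ → R) (j : ℕ) : Module.End R R[X] :=
  α j • LinearMap.mulLeft R Polynomial.X + β j • Polynomial.derivative

theorem letterOp_apply {R : Type*} [CommRing R] (α β : ℕ → R) (j : ℕ) (p : R[X]) :
    letterOp α β j p = α j • (Polynomial.X * p) + β j • derivative p := rfl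

theorem lie_letterOp {R : Type*} [CommRing R] (α β : ℕ → R) (i j : ℕ) :
    ⁅letterOp α β i, letterOp α β j⁆ = (β i * α j - α i * β j) • (1 : Module.End R R[X]) := by
  refine LinearMap.ext fun p => ?_
  simp only [Ring.lie_def, LinearMap.sub_apply, Module.End.mul_apply, letterOp_apply,
    LinearMap.smul_apply, Module.End.one_apply, smul_eq_C_mul, derivative_add, derivative_mul,
    derivative_C, derivative_X, C_sub, C_mul]
  ring

/-- Commutators are scalars, namely `2 × 2` minors of the coefficients; `St₃` and `T₄` then become
the classical identities among vectors of a rank-two module and their minors. -/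
theorem straighteningRelations_letterOp {R : Type*} [CommRing R] (α β : ℕ → R) :
    StraighteningRelations (letterOp α β) where
  gamma3 i j k := by
    rw [Gamma3, lie_letterOp, Ring.lie_def, smul_mul_assoc, mul_smul_comm, one_mul, mul_one,
      sub_self]
  st3 i j k := by
    simp only [St3, lie_letterOp, mul_smul_comm, mul_one]
    refine LinearMap.ext fun p => ?_
    simp only [LinearMap.sub_apply, LinearMap.add_apply, letterOp_apply, LinearMap.smul_apply,
      smul_eq_C_mul, C_sub, C_mul, LinearMap.zero_apply]
    ring
  t4 i j k l := by
    simp only [T4, lie_letterOp, smul_mul_smul_comm, mul_one]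
    refine LinearMap.ext fun p => ?_
    simp only [LinearMap.sub_apply, LinearMap.add_apply, LinearMap.smul_apply, smul_eq_C_mul,
      C_sub, C_mul, LinearMap.zero_apply]
    ring

/-! ### Generic letters and leading monomials. -/

section Generic

variable (F : Type*) [Field F]

/-- The action of the generic element `αⱼ x + βⱼ y`, where `αⱼ` and `βⱼ` are independent
indeterminates. -/
noncomputable def genericLetter :
    ℕ → Module.End (MvPolynomial (ℕ ⊕ ℕ) F) (MvPolynomial (ℕ ⊕ ℕ) F)[X] :=
  letterOp (fun j => MvPolynomial.X (Sum.inl j)) fun j => MvPolynomial.X (Sum.inr j)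

/-- The action of the free algebra through the generic elements. -/
noncomputable def genericAction : FreeAlg F →ₐ[F] Module.End (MvPolynomial (ℕ ⊕ ℕ) F)
    (MvPolynomial (ℕ ⊕ ℕ) F)[X] :=
  FreeAlgebra.lift F (genericLetter F)

/-- The weight for which `αⱼ` has weight `j`, `βⱼ` has weight `0` and `X` has weight `1`. -/
noncomputable def weight (k : (ℕ ⊕ ℕ →₀ ℕ) × ℕ) : ℕ :=
  Finsupp.weight (Sum.elim id fun _ => 0 : ℕ ⊕ ℕ → ℕ) k.1 + k.2

/-- The monomial with the given exponents. -/
noncomputable def genericMonomial (k : (ℕ ⊕ ℕ →₀ ℕ) × ℕ) : (MvPolynomial (ℕ ⊕ ℕ) F)[X] :=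
  Polynomial.monomial k.2 (MvPolynomial.monomial k.1 1)

/-- The span of the monomials of weight less than `n`. -/
noncomputable def lowerWeight (n : ℕ) : Submodule F (MvPolynomial (ℕ ⊕ ℕ) F)[X] :=
  Submodule.span F (genericMonomial F '' {k | weight k < n})

/-- The coefficient of a monomial. -/
noncomputable def genericCoeff (k : (ℕ ⊕ ℕ →₀ ℕ) × ℕ) :
    (MvPolynomial (ℕ ⊕ ℕ) F)[X] →ₗ[F] F :=
  MvPolynomial.lcoeff F k.1 ∘ₗ (Polynomial.lcoeff (MvPolynomial (ℕ ⊕ ℕ) F) k.2).restrictScalars F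

variable {F}

theorem weight_add (k l : (ℕ ⊕ ℕ →₀ ℕ) × ℕ) : weight (k + l) = weight k + weight l := by
  simp only [weight, Prod.fst_add, Prod.snd_add, map_add]
  ring

theorem lowerWeight_mono {m n : ℕ} (h : m ≤ n) : lowerWeight F m ≤ lowerWeight F n :=
  Submodule.span_mono (Set.image_mono fun _ (hk : _ < _) => lt_of_lt_of_le hk h)

theorem genericCoeff_genericMonomial (k l : (ℕ ⊕ ℕ →₀ ℕ) × ℕ) :
    genericCoeff F k (genericMonomial F l) = if l = k then 1 else 0 := by
  classical
  simp only [genericCoeff, genericMonomial, LinearMap.comp_apply, LinearMap.restrictScalars_apply,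
    Polynomial.lcoeff_apply, Polynomial.coeff_monomial, MvPolynomial.lcoeff_apply]
  by_cases h2 : l.2 = k.2
  · simp [h2, MvPolynomial.coeff_monomial, Prod.ext_iff]
  · simp [h2, Prod.ext_iff]

theorem genericCoeff_eq_zero {n : ℕ} {p : (MvPolynomial (ℕ ⊕ ℕ) F)[X]} (hp : p ∈ lowerWeight F n)
    {k : (ℕ ⊕ ℕ →₀ ℕ) × ℕ} (hk : n ≤ weight k) : genericCoeff F k p = 0 := by
  have : lowerWeight F n ≤ LinearMap.ker (genericCoeff F k) := by
    rw [lowerWeight, Submodule.span_le]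
    rintro _ ⟨l, hl, rfl⟩
    rw [SetLike.mem_coe, LinearMap.mem_ker, genericCoeff_genericMonomial, if_neg]
    rintro rfl
    exact absurd hl (not_lt.2 hk)
  exact this hp

theorem genericMonomial_mem {n : ℕ} {k : (ℕ ⊕ ℕ →₀ ℕ) × ℕ} (hk : weight k < n) :
    genericMonomial F k ∈ lowerWeight F n :=
  Submodule.subset_span ⟨k, hk, rfl⟩

/-- `p` is the sum of the monomial `k` and of monomials of lower weight. -/
def HasLead (p : (MvPolynomial (ℕ ⊕ ℕ) F)[X]) (k : (ℕ ⊕ ℕ →₀ ℕ) × ℕ) : Prop :=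
  p - genericMonomial F k ∈ lowerWeight F (weight k)

/-- A linear operator that raises the weight of monomials by at most `d` maps polynomials of
weight less than `n` to polynomials of weight less than `n + d`. -/
theorem map_mem_lowerWeight (T : (MvPolynomial (ℕ ⊕ ℕ) F)[X] →ₗ[F] (MvPolynomial (ℕ ⊕ ℕ) F)[X])
    {d : ℕ} (hT : ∀ k, T (genericMonomial F k) ∈ lowerWeight F (weight k + d + 1)) {n : ℕ}
    {p : (MvPolynomial (ℕ ⊕ ℕ) F)[X]} (hp : p ∈ lowerWeight F n) :
    T p ∈ lowerWeight F (n + d) := by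
  have : lowerWeight F n ≤ (lowerWeight F (n + d)).comap T := by
    conv_lhs => rw [lowerWeight]
    rw [Submodule.span_le]
    rintro _ ⟨l, hl, rfl⟩
    have hl : weight l < n := hl
    exact lowerWeight_mono (by omega) (hT l)
  exact this hp

/-- A linear operator with leading term `g` of weight `d` on monomials multiplies the leading
monomial by `g`. -/
theorem HasLead.map (T : (MvPolynomial (ℕ ⊕ ℕ) F)[X] →ₗ[F] (MvPolynomial (ℕ ⊕ ℕ) F)[X])
    (g : (ℕ ⊕ ℕ →₀ ℕ) × ℕ) (hT : ∀ k, HasLead (T (genericMonomial F k)) (g + k))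
    {p : (MvPolynomial (ℕ ⊕ ℕ) F)[X]} {k : (ℕ ⊕ ℕ →₀ ℕ) × ℕ} (hp : HasLead p k) :
    HasLead (T p) (g + k) := by
  have hw : ∀ k, weight (g + k) = weight k + weight g := fun k => by rw [weight_add, add_comm]
  have h1 : T (p - genericMonomial F k) ∈ lowerWeight F (weight k + weight g) := by
    refine map_mem_lowerWeight T (fun l => ?_) hp
    have h2 := hT l
    rw [HasLead, hw] at h2
    rw [← sub_add_cancel (T (genericMonomial F l)) (genericMonomial F (g + l))]
    exact add_mem (lowerWeight_mono (Nat.le_succ _) h2) (genericMonomial_mem (by rw [hw]; omega))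
  rw [HasLead, hw, ← sub_add_sub_cancel _ (T (genericMonomial F k)), ← map_sub, ← hw]
  exact add_mem (hw k ▸ h1) (hT k)

theorem X_smul_genericMonomial (s : ℕ ⊕ ℕ) (k : (ℕ ⊕ ℕ →₀ ℕ) × ℕ) :
    (MvPolynomial.X s : MvPolynomial (ℕ ⊕ ℕ) F) • genericMonomial F k =
      genericMonomial F ((Finsupp.single s 1, 0) + k) := by
  simp [genericMonomial, Polynomial.smul_monomial, MvPolynomial.X, MvPolynomial.monomial_mul]

theorem X_mul_genericMonomial (k : (ℕ ⊕ ℕ →₀ ℕ) × ℕ) :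
    Polynomial.X * genericMonomial F k = genericMonomial F ((0, 1) + k) := by
  simp [genericMonomial, Polynomial.X_mul_monomial, add_comm]

theorem weight_mk (m : ℕ ⊕ ℕ →₀ ℕ) (n : ℕ) : weight (m, n) = weight (m, 0) + n := by
  simp [weight]

@[simp]
theorem weight_single_inl (j : ℕ) : weight (Finsupp.single (Sum.inl j) 1, 0) = j := by
  simp [weight, Finsupp.weight_single]

@[simp]
theorem weight_single_inr (j : ℕ) : weight (Finsupp.single (Sum.inr j) 1, 0) = 0 := by
  simp [weight, Finsupp.weight_single]

/-- Multiplication by `αⱼ X` raises the weight by `j + 1`, while `βⱼ d/dX` never raises it; giving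
`X` weight `1` keeps this strict for `j = 0`. -/
theorem HasLead.genericLetter {p : (MvPolynomial (ℕ ⊕ ℕ) F)[X]} {k : (ℕ ⊕ ℕ →₀ ℕ) × ℕ}
    (hp : HasLead p k) (j : ℕ) :
    HasLead (genericLetter F j p) ((Finsupp.single (Sum.inl j) 1, 1) + k) := by
  let T : (MvPolynomial (ℕ ⊕ ℕ) F)[X] →ₗ[F] (MvPolynomial (ℕ ⊕ ℕ) F)[X] :=
    (WeylWeakIdentities.genericLetter F j).restrictScalars F
  have hT : ∀ q, T q = WeylWeakIdentities.genericLetter F j q := fun _ => rfl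
  rw [← hT]
  refine HasLead.map T _ (fun k => ?_) hp
  obtain ⟨m, n⟩ := k
  rw [hT, WeylWeakIdentities.genericLetter, letterOp_apply, X_mul_genericMonomial,
    X_smul_genericMonomial, HasLead, ← add_assoc,
    show ((Finsupp.single (Sum.inl j) 1, 0) + (0, 1) : (ℕ ⊕ ℕ →₀ ℕ) × ℕ) =
      (Finsupp.single (Sum.inl j) 1, 1) by simp, add_sub_cancel_left]
  -- For `n = 0` the truncated exponent is harmless, because the scalar vanishes.
  have h : derivative (genericMonomial F (m, n)) = (n : F) • genericMonomial F (m, n - 1) := by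
    rw [genericMonomial, derivative_monomial, genericMonomial, Polynomial.smul_monomial,
      Algebra.smul_def, map_natCast, mul_comm]
  rw [h, smul_comm, X_smul_genericMonomial]
  refine Submodule.smul_mem _ _ (genericMonomial_mem ?_)
  rw [weight_add, weight_add, weight_single_inr, weight_mk _ 1, weight_single_inl, weight_mk m n,
    weight_mk m (n - 1)]
  omega

/-- The commutator is the scalar `βᵢ αⱼ - αᵢ βⱼ`, whose terms have weights `j` and `i`. -/
theorem HasLead.commutator {p : (MvPolynomial (ℕ ⊕ ℕ) F)[X]} {k : (ℕ ⊕ ℕ →₀ ℕ) × ℕ}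
    (hp : HasLead p k) {i j : ℕ} (hij : i < j) :
    HasLead (⁅WeylWeakIdentities.genericLetter F i, WeylWeakIdentities.genericLetter F j⁆ p)
      ((Finsupp.single (Sum.inr i) 1 + Finsupp.single (Sum.inl j) 1, 0) + k) := by
  rw [WeylWeakIdentities.genericLetter, lie_letterOp, LinearMap.smul_apply, Module.End.one_apply]
  let T : (MvPolynomial (ℕ ⊕ ℕ) F)[X] →ₗ[F] (MvPolynomial (ℕ ⊕ ℕ) F)[X] :=
    LinearMap.restrictScalars F (LinearMap.lsmul (MvPolynomial (ℕ ⊕ ℕ) F) _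
      (MvPolynomial.X (Sum.inr i) * MvPolynomial.X (Sum.inl j) -
        MvPolynomial.X (Sum.inl i) * MvPolynomial.X (Sum.inr j)))
  have hT : ∀ q, T q = ((MvPolynomial.X (Sum.inr i) * MvPolynomial.X (Sum.inl j) -
      MvPolynomial.X (Sum.inl i) * MvPolynomial.X (Sum.inr j) : MvPolynomial (ℕ ⊕ ℕ) F)) • q :=
    fun _ => rfl
  rw [← hT]
  refine HasLead.map T _ (fun k => ?_) hp
  rw [hT, sub_smul,
    mul_smul, mul_smul, X_smul_genericMonomial, X_smul_genericMonomial, X_smul_genericMonomial,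
    X_smul_genericMonomial, HasLead, ← add_assoc,
    show ((Finsupp.single (Sum.inr i) 1, 0) + (Finsupp.single (Sum.inl j) 1, 0) :
      (ℕ ⊕ ℕ →₀ ℕ) × ℕ) = (Finsupp.single (Sum.inr i) 1 + Finsupp.single (Sum.inl j) 1, 0) by simp,
    sub_sub_cancel_left]
  refine neg_mem (genericMonomial_mem ?_)
  have : weight (Finsupp.single (Sum.inr i) 1 + Finsupp.single (Sum.inl j) 1, 0) = j := by
    simp [weight, Finsupp.weight_single]
  simp [weight_add, this, hij]

end Generic

/-! ### Independence of standard tableaux. -/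

section Independence

variable {F : Type*} [Field F]

/-- The exponents of the leading monomial of a tableau in the generic action on `1`. -/
noncomputable def leadExponent (as : List ℕ) (P : List (ℕ × ℕ)) : (ℕ ⊕ ℕ →₀ ℕ) × ℕ :=
  (Multiset.toFinsupp ((as.map Sum.inl ++ (P.map fun p => Sum.inl p.2) ++
    P.map fun p => Sum.inr p.1 : List (ℕ ⊕ ℕ)) : Multiset (ℕ ⊕ ℕ)), as.length)

theorem leadExponent_cons_left (j : ℕ) (as : List ℕ) (P : List (ℕ × ℕ)) :
    leadExponent (j :: as) P = (Finsupp.single (Sum.inl j) 1, 1) + leadExponent as P := by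
  simp only [leadExponent, List.map_cons, List.cons_append, ← Multiset.cons_coe,
    ← Multiset.singleton_add, Multiset.toFinsupp_add, Multiset.toFinsupp_singleton,
    List.length_cons, Prod.mk_add_mk, add_comm]

theorem leadExponent_cons_right (p : ℕ × ℕ) (P : List (ℕ × ℕ)) :
    leadExponent [] (p :: P) =
      (Finsupp.single (Sum.inr p.1) 1 + Finsupp.single (Sum.inl p.2) 1, 0) + leadExponent [] P := by
  simp only [leadExponent, List.map_cons, List.map_nil, List.nil_append, List.cons_append,
    ← Multiset.cons_coe, ← Multiset.coe_add, ← Multiset.singleton_add, Multiset.toFinsupp_add,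
    Multiset.toFinsupp_singleton, Prod.mk_add_mk, List.length_nil, add_zero]
  congr 1
  abel

/-- A sorted list is determined by its multiset: the `α` exponents give the letters followed by the
second indices, the power of `X` tells where to cut, and the `β` exponents give the first indices.
-/
theorem IsStandard.eq_of_leadExponent_eq {as as' : List ℕ} {P P' : List (ℕ × ℕ)}
    (h : IsStandard as P) (h' : IsStandard as' P') (he : leadExponent as P = leadExponent as' P') :
    as = as' ∧ P = P' := by
  obtain ⟨he, hl⟩ := Prod.ext_iff.1 he
  have hperm := Multiset.coe_eq_coe.1 (Multiset.toFinsupp.injective he)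
  have h1 := hperm.filterMap Sum.getLeft?
  have h2 := hperm.filterMap Sum.getRight?
  simp only [List.filterMap_append, List.filterMap_map, Function.comp_def, Sum.getLeft?_inl,
    Sum.getLeft?_inr, Sum.getRight?_inl, Sum.getRight?_inr, List.filterMap_none, List.append_nil,
    List.nil_append, List.filterMap_some] at h1 h2
  have e1 : ∀ P : List (ℕ × ℕ), (P.filterMap fun p => some p.2) = P.map Prod.snd := fun P =>
    congrFun (List.filterMap_eq_map' (f := Prod.snd)) P
  have e2 : ∀ P : List (ℕ × ℕ), (P.filterMap fun p => some p.1) = P.map Prod.fst := fun P =>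
    congrFun (List.filterMap_eq_map' (f := Prod.fst)) P
  rw [e1, e1] at h1
  rw [e2, e2] at h2
  obtain ⟨rfl, h3⟩ := List.append_inj (h1.eq_of_pairwise' h.1 h'.1) hl
  have h4 := h2.eq_of_pairwise' h.2.1 h'.2.1
  refine ⟨rfl, ?_⟩
  rw [← List.zip_unzip P, ← List.zip_unzip P', List.unzip_eq_map, List.unzip_eq_map, h3, h4]

variable (F) in
theorem straighteningRelations_genericLetter : StraighteningRelations (genericLetter F) :=
  straighteningRelations_letterOp _ _

theorem hasLead_tableau (as : List ℕ) {P : List (ℕ × ℕ)} (hP : ∀ p ∈ P, p.1 < p.2) :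
    HasLead (tableau (genericLetter F) as P 1) (leadExponent as P) := by
  induction as with
  | nil =>
    induction P with
    | nil =>
      have : genericMonomial F (leadExponent [] []) = 1 := by
        simp [genericMonomial, leadExponent]
      simp [tableau, HasLead, this]
    | cons p P ih =>
      rw [(straighteningRelations_genericLetter F).tableau_cons_right, leadExponent_cons_right,
        Module.End.mul_apply]
      exact (ih fun q hq => hP q (List.mem_cons_of_mem _ hq)).commutator
        (hP p List.mem_cons_self)
  | cons j as ih =>
    have e : tableau (genericLetter F) (j :: as) P =
        genericLetter F j * tableau (genericLetter F) as P := by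
      simp only [tableau, List.map_cons, List.prod_cons, mul_assoc]
    rw [leadExponent_cons_left, e, Module.End.mul_apply]
    exact ih.genericLetter j

theorem map_tableau {A B : Type*} [Ring A] [Ring B] (φ : A →+* B) (a : ℕ → A) (as : List ℕ)
    (P : List (ℕ × ℕ)) : φ (tableau a as P) = tableau (fun j => φ (a j)) as P := by
  simp [tableau, map_list_prod, List.map_map, Function.comp_def, Ring.lie_def]

/-- Standard tableaux in the free algebra act on `1` as linearly independent elements. -/
theorem eq_zero_of_genericAction_eq_zero (c : List ℕ × List (ℕ × ℕ) →₀ F)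
    (hc : ∀ t ∈ c.support, IsStandard t.1 t.2)
    (h0 : genericAction F (c.linearCombination F fun t => tableau X t.1 t.2) 1 = 0) : c = 0 := by
  by_contra hne
  obtain ⟨t, ht, hmax⟩ := c.support.exists_max_image (fun t => weight (leadExponent t.1 t.2))
    (Finsupp.support_nonempty_iff.2 hne)
  have hcoeff : ∀ s ∈ c.support, genericCoeff F (leadExponent t.1 t.2)
      (genericAction F (tableau X s.1 s.2) 1) = if s = t then 1 else 0 := by
    intro s hs
    have h1 : genericAction F (tableau X s.1 s.2) = tableau (genericLetter F) s.1 s.2 := by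
      have := map_tableau (A := FreeAlg F) (B := Module.End (MvPolynomial (ℕ ⊕ ℕ) F)
        (MvPolynomial (ℕ ⊕ ℕ) F)[X]) (genericAction F).toRingHom X s.1 s.2
      simpa [genericAction] using this
    have h2 := hasLead_tableau (F := F) s.1 (hc s hs).2.2
    rw [← h1] at h2
    -- As `t` has maximal weight, the lower-weight part of any tableau in the support cannot reach
    -- this coefficient.
    have h3 := genericCoeff_eq_zero h2 (hmax s hs)
    rw [map_sub, sub_eq_zero, genericCoeff_genericMonomial] at h3
    rw [h3]
    refine if_congr ⟨fun he => ?_, fun he => he ▸ rfl⟩ rfl rfl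
    obtain ⟨e1, e2⟩ := (hc s hs).eq_of_leadExponent_eq (hc t ht) he
    exact Prod.ext e1 e2
  have hsum := congrArg (genericCoeff F (leadExponent t.1 t.2)) h0
  rw [Finsupp.linearCombination_apply, Finsupp.sum, map_sum, LinearMap.sum_apply, map_sum,
    map_zero, Finset.sum_eq_single t] at hsum
  · rw [map_smul, LinearMap.smul_apply, map_smul, hcoeff t ht, if_pos rfl, smul_eq_mul,
      mul_one] at hsum
    exact Finsupp.mem_support_iff.1 ht hsum
  · intro s hs hst
    rw [map_smul, LinearMap.smul_apply, map_smul, hcoeff s hs, if_neg hst, smul_zero]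
  · exact fun h => absurd ht h

end Independence

/-! ### From the Weyl algebra to the generic action. -/

section Specialization

variable {F : Type*} [Field F]

/-- The action of the Weyl algebra on `F[X]` in which `x` acts as multiplication by `X` and `y` as
the derivative. -/
noncomputable def weylAction : WeylAlgebra F →ₐ[F] Module.End F F[X] :=
  RingQuot.liftAlgHom F ⟨FreeAlgebra.lift F ![LinearMap.mulLeft F Polynomial.X, derivative], by
    rintro _ _ ⟨⟩
    refine LinearMap.ext fun p => ?_
    simp [derivative_mul, add_comm]⟩

theorem weylAction_weylX : weylAction (weylX F) = LinearMap.mulLeft F Polynomial.X := by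
  simp [weylAction, weylX]

theorem weylAction_weylY : weylAction (weylY F) = derivative := by
  simp [weylAction, weylY]

/-- Only the passage from zero in the Weyl algebra to the zero operator is needed, so it does not
matter that the action on `F[X]` fails to be faithful in positive characteristic. -/
theorem IsWeakIdentity.lift_letterOp {f : FreeAlg F} (hf : IsWeakIdentity F f) (α β : ℕ → F) :
    FreeAlgebra.lift F (letterOp α β) f = 0 := by
  have h := hf (fun j => α j • weylX F + β j • weylY F) fun j =>
    add_mem (Submodule.smul_mem _ _ (Submodule.subset_span (by simp)))
      (Submodule.smul_mem _ _ (Submodule.subset_span (by simp)))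
  have hcomp : weylAction.comp (FreeAlgebra.lift F fun j => α j • weylX F + β j • weylY F) =
      FreeAlgebra.lift F (letterOp α β) := by
    refine FreeAlgebra.hom_ext (funext fun j => ?_)
    simp [letterOp, weylAction_weylX, weylAction_weylY]
  rw [← hcomp, AlgHom.comp_apply, h, map_zero]

theorem map_eval_genericAction (v : ℕ ⊕ ℕ → F) (f : FreeAlg F)
    (p : (MvPolynomial (ℕ ⊕ ℕ) F)[X]) :
    (genericAction F f p).map (MvPolynomial.eval v) =
      FreeAlgebra.lift F (letterOp (fun j => v (Sum.inl j)) fun j => v (Sum.inr j)) f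
        (p.map (MvPolynomial.eval v)) := by
  induction f using FreeAlgebra.induction generalizing p with
  | grade0 r =>
    rw [AlgHom.commutes, AlgHom.commutes, Module.algebraMap_end_apply,
      Module.algebraMap_end_apply]
    ext n
    simp [MvPolynomial.smul_eval]
  | grade1 i =>
    simp [genericAction, genericLetter, letterOp_apply, smul_eq_C_mul, derivative_map]
  | mul f g hf hg => simp [hf, hg]
  | add f g hf hg => simp [hf, hg]

/-- Every coefficient of the result is a polynomial in the `αⱼ`, `βⱼ` vanishing at all points over
an infinite field. -/
theorem IsWeakIdentity.genericAction_eq_zero [Infinite F] {f : FreeAlg F}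
    (hf : IsWeakIdentity F f) : genericAction F f = 0 := by
  refine LinearMap.ext fun p => Polynomial.ext fun n => MvPolynomial.funext fun v => ?_
  rw [← Polynomial.coeff_map, map_eval_genericAction, hf.lift_letterOp]
  simp

end Specialization

/-! ### Comparison of the ideal with the weak identities. -/

section Main

variable (F : Type*) [Field F]

theorem straighteningRelations_mk :
    StraighteningRelations fun i => (idealI F).ringCon.mk' (X i) := by
  have key : ∀ f ∈ ({f | ∃ i j k : ℕ, f = Gamma3 (X i) (X j) (X k)} ∪
      {f | ∃ i j k : ℕ, f = St3 (X i) (X j) (X k)} ∪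
      {f | ∃ i j k l : ℕ, f = T4 (X i) (X j) (X k) (X l)} : Set (FreeAlg F)),
      (idealI F).ringCon.mk' f = 0 := fun f hf => by
    rw [← TwoSidedIdeal.mem_ker, TwoSidedIdeal.ker_ringCon_mk']
    exact TwoSidedIdeal.subset_span hf
  refine ⟨fun i j k => ?_, fun i j k => ?_, fun i j k l => ?_⟩
  · simpa only [Gamma3, Ring.lie_def, map_sub, map_mul] using
      key (Gamma3 (X i) (X j) (X k)) (.inl (.inl ⟨i, j, k, rfl⟩))
  · simpa only [St3, Ring.lie_def, map_sub, map_mul, map_add] using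
      key (St3 (X i) (X j) (X k)) (.inl (.inr ⟨i, j, k, rfl⟩))
  · simpa only [T4, Ring.lie_def, map_sub, map_mul, map_add] using
      key (T4 (X i) (X j) (X k) (X l)) (.inr ⟨i, j, k, l, rfl⟩)

theorem idealI_le_ker_genericAction : idealI F ≤ TwoSidedIdeal.ker (genericAction F) := by
  refine TwoSidedIdeal.span_le.2 ?_
  have h := straighteningRelations_genericLetter F
  rintro _ ((⟨i, j, k, rfl⟩ | ⟨i, j, k, rfl⟩) | ⟨i, j, k, l, rfl⟩) <;>
    rw [SetLike.mem_coe, TwoSidedIdeal.mem_ker]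
  · simpa only [Gamma3, Ring.lie_def, map_sub, map_mul, genericAction, FreeAlgebra.lift_ι_apply]
      using h.gamma3 i j k
  · simpa only [St3, Ring.lie_def, map_sub, map_mul, map_add, genericAction,
      FreeAlgebra.lift_ι_apply] using h.st3 i j k
  · simpa only [T4, Ring.lie_def, map_sub, map_mul, map_add, genericAction,
      FreeAlgebra.lift_ι_apply] using h.t4 i j k l

variable {F}

/-- Modulo the ideal, every element is a linear combination of standard tableaux. -/
theorem exists_sub_mem_idealI (f : FreeAlg F) :
    ∃ c : List ℕ × List (ℕ × ℕ) →₀ F, (∀ t ∈ c.support, IsStandard t.1 t.2) ∧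
      f - (c.linearCombination F fun t => tableau X t.1 t.2) ∈ idealI F := by
  have h := (straighteningRelations_mk F).lift_mem_standardSpan f
  rw [standardSpan, Finsupp.mem_span_image_iff_linearCombination] at h
  obtain ⟨c, hc, he⟩ := h
  refine ⟨c, fun t ht => hc ht, ?_⟩
  have hlift : FreeAlgebra.lift F (fun i => (idealI F).ringCon.mk' (X i)) =
      (idealI F).ringCon.mkₐ F := by
    refine FreeAlgebra.hom_ext (funext fun i => ?_)
    simp
  rw [hlift] at he
  rw [← TwoSidedIdeal.rel_iff, ← RingCon.eq]
  change (idealI F).ringCon.mkₐ F _ = (idealI F).ringCon.mkₐ F _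
  rw [← he, Finsupp.linearCombination_apply, Finsupp.linearCombination_apply, Finsupp.sum,
    Finsupp.sum, map_sum]
  refine Finset.sum_congr rfl fun t _ => ?_
  rw [map_smul]
  exact congrArg _ (map_tableau (idealI F).ringCon.mk' X t.1 t.2).symm

/-- Every weak polynomial identity for the pair `(A₁, V)`, of whatever degree, lies in the
ideal. -/
theorem IsWeakIdentity.mem_idealI [Infinite F] {f : FreeAlg F} (hf : IsWeakIdentity F f) :
    f ∈ idealI F := by
  obtain ⟨c, hc, hmem⟩ := exists_sub_mem_idealI f
  have h0 := idealI_le_ker_genericAction F hmem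
  rw [TwoSidedIdeal.mem_ker, map_sub] at h0
  have hc0 := eq_zero_of_genericAction_eq_zero c hc (by
    rw [← sub_eq_zero.1 h0, hf.genericAction_eq_zero]; rfl)
  simpa [hc0] using hmem

end Main

end WeylWeakIdentities

theorem mainTheorem4 (F : Type*) [Field F] [Infinite F] (f : WeylWeakIdentities.FreeAlg F)
    (hf : WeylWeakIdentities.IsWeakIdentity F f) (hdeg : WeylWeakIdentities.degree f = 5) :
    f ∈ WeylWeakIdentities.idealI F :=
  hf.mem_idealI
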